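/- **Theorem 1** (Zeilberger's theorem, the alternating sign matrix conjecture). An alternating sign matrix is a square matrix of $0$'s, $1$'s and $-1$'s such that the non-zero elements in each row and each column alternate between $1$ and $-1$ and begin and end with $1$ (in particular, no row or column is zero). For every $n \ge 0$, the number of $n\times n$ alternating sign matrices is $$A(n) = \frac{1!\,4!\,7!\cdots(3n-2)!}{n!\,(n+1)!\,(n+2)!\cdots(2n-1)!} = \prod_{k=0}^{n-1}\frac{(3k+1)!}{(n+k)!},$$ where empty products are $1$. -/

import Mathlib

/-- A finite sequence of `0`'s, `1`'s and `-1`'s that has non-zero entries, whose non-zero entries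
alternate between `1` and `-1`, and whose first and last non-zero entries are `1`. -/
structure IsAlternatingSeq {n : ℕ} (v : Fin n → ℤ) : Prop where
  entries : ∀ i, v i = 0 ∨ v i = 1 ∨ v i = -1
  exists_ne_zero : ∃ i, v i ≠ 0
  first_eq_one : ∀ i, v i ≠ 0 → (∀ j, j < i → v j = 0) → v i = 1
  last_eq_one : ∀ i, v i ≠ 0 → (∀ j, i < j → v j = 0) → v i = 1
  alternate : ∀ i j, i < j → v i ≠ 0 → v j ≠ 0 → (∀ k, i < k → k < j → v k = 0) → v j = -v i

/-- An alternating sign matrix: every row and every column is an alternating sequence. -/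
structure IsAlternatingSignMatrix {n : ℕ} (A : Matrix (Fin n) (Fin n) ℤ) : Prop where
  row : ∀ i, IsAlternatingSeq fun j => A i j
  col : ∀ j, IsAlternatingSeq fun i => A i j

/-!
Alternating sign matrices are the states of the six-vertex model with domain wall boundary: the
partial row and column sums of the matrix, which lie in `{0, 1}`, are the states of the edges of the
square lattice. Give row `i` a parameter `x i` and column `j` a parameter `y j`, and choose the
weights (`vertexWeight`) at a primitive cube root of unity `ω`, normalized so that at `x = y = 1`
they all equal `1`. Then the partition function `Z` at `x = y = 1` counts the matrices
(`card_walkMatrices`).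

At this value of the crossing parameter, `Z` is, up to a constant, a Schur function in all `2 * n`
parameters (Okada, Stroganov). With `z = (x 0, y 0, x 1, y 1, …)`, this is the identity
`partitionFn_mul_alternant`:

  `Z * det (z i ^ j) = 3 ^ (-n * (n - 1) / 2) * det (z i ^ e j)`,  `e = 0, 1, 3, 4, 6, 7, …`.

It holds by induction on `n` and interpolation in `x 0`. The Yang–Baxter equation
(`rowTransfer_columnExchange`) makes `Z` symmetric in the column parameters (`partitionFn_perm`). At
`x 0 = ω * y 0` the top left entry has to be `1`, so the first row and column are determined and `Z`
reduces to the partition function of size `n - 1` (`partitionFn_mul_cons`); the two determinants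
reduce in the same way (`alternant_id_add_two`, `alternant_wheelExponent_add_two`). By symmetry the
identity holds at `x 0 = ω * y j` for all `j`. It also holds where `x 0` is another parameter,
because there both determinants vanish. These are more points than the degree in `x 0`. The
intertwiners and the interpolation need the parameters to be generic; it is enough to treat distinct
positive reals, as `ω` is not real.

At the geometric progression `z i = t ^ i` both determinants are of Vandermonde type and factor.
Letting `t` tend to `1` evaluates `Z` at `x = y = 1` as a ratio of products of differences
(`partitionFn_one_mul`), which the recursion from `n` to `n + 1` turns into the product of
factorials (`prod_wheelExponent_mul`).
-/

/-! ### The six-vertex model at a cube root of unity -/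

/-- The Boltzmann weight of a vertex of the square lattice with row parameter `x` and column
parameter `y`, whose left, top, right and bottom edges are in the states `h`, `s`, `k`, `t`. In
terms of matrix entries, `h` and `s` are the sums of the entries to the left of and above the
vertex, `k` and `t` are the sums including the vertex, and the entry itself is `k - h = t - s`. The
normalization makes all six weights equal to `1` at `x = y = 1`. -/
noncomputable def vertexWeight (ω x y : ℂ) : Bool → Bool → Bool → Bool → ℂ
  | false, false, false, false => (2 + ω) / 3 * (x - ω * y)
  | true, true, true, true => (2 + ω) / 3 * (x - ω * y)
  | false, true, false, true => (2 + ω) / 3 * (y - ω * x)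
  | true, false, true, false => (2 + ω) / 3 * (y - ω * x)
  | false, false, true, true => 1
  | true, true, false, false => x * y
  | _, _, _, _ => 0

/-- The transfer operator of one row of vertices with row parameter `x` and column parameters `ys`,
whose leftmost edge is in the state `h` and whose rightmost edge is in the state `true`. It acts on
functions of the states of the vertical edges: the argument `f` is read below the row and the
result above it. States of the wrong length do not matter, as the functions are only evaluated
at lists with one entry for each column. -/
noncomputable def rowTransfer (ω x : ℂ) : List ℂ → Bool → (List Bool → ℂ) → List Bool → ℂ
  | [], h, f, l => if h then f l else 0
  | _ :: _, _, _, [] => 0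
  | y :: ys, h, f, s :: l => ∑ k : Bool, ∑ t : Bool,
      vertexWeight ω x y h s k t * rowTransfer ω x ys k (fun l' => f (t :: l')) l

/-- The indicator function of the state in which all vertical edges are `true`. -/
def allTrue (l : List Bool) : ℂ := if l.all id then 1 else 0

/-- The partition function of the six-vertex model with row parameters `xs` and column parameters
`ys`, as a function of the state of the upper boundary. All edges of the left boundary are `false`;
those of the right and the lower boundary are `true`. -/
noncomputable def partitionFn (ω : ℂ) : List ℂ → List ℂ → List Bool → ℂ
  | [], _ => allTrue
  | x :: xs, ys => rowTransfer ω x ys false (partitionFn ω xs ys)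

theorem rowTransfer_cons (ω x y : ℂ) (ys : List ℂ) (h : Bool) (f : List Bool → ℂ) (s : Bool)
    (l : List Bool) :
    rowTransfer ω x (y :: ys) h f (s :: l) = ∑ k : Bool, ∑ t : Bool,
      vertexWeight ω x y h s k t * rowTransfer ω x ys k (fun l' => f (t :: l')) l := rfl

theorem rowTransfer_add (ω x : ℂ) (ys : List ℂ) (h : Bool) (f g : List Bool → ℂ) (l : List Bool) :
    rowTransfer ω x ys h (fun l => f l + g l) l =
      rowTransfer ω x ys h f l + rowTransfer ω x ys h g l := by
  induction ys generalizing h f g l with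
  | nil => cases h <;> simp [rowTransfer]
  | cons y ys ih =>
    cases l with
    | nil => simp [rowTransfer]
    | cons s l => simp only [rowTransfer_cons, ih, mul_add, Finset.sum_add_distrib]

theorem rowTransfer_smul (ω x : ℂ) (ys : List ℂ) (h : Bool) (c : ℂ) (f : List Bool → ℂ)
    (l : List Bool) :
    rowTransfer ω x ys h (fun l => c * f l) l = c * rowTransfer ω x ys h f l := by
  induction ys generalizing h f l with
  | nil => cases h <;> simp [rowTransfer]
  | cons y ys ih =>
    cases l with
    | nil => simp [rowTransfer]
    | cons s l => simp only [rowTransfer_cons, ih, Finset.mul_sum, mul_left_comm]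

/-! ### The Yang–Baxter equation -/

/-- The operator on functions of the states of the vertical edges that exchanges the parameters
`y` and `z` of the first two columns: an `R`-matrix acting on the first two edges, normalized to
fix the states in which these two agree. -/
noncomputable def columnExchange (ω y z : ℂ) : (List Bool → ℂ) →ₗ[ℂ] (List Bool → ℂ) where
  toFun f
    | false :: true :: l => ((1 - ω) * y * f (false :: true :: l) +
        (1 + ω) * (z - y) * f (true :: false :: l)) / (z - ω * y)
    | true :: false :: l => ((1 + ω) * (z - y) * f (false :: true :: l) +
        (1 - ω) * z * f (true :: false :: l)) / (z - ω * y)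
    | l => f l
  map_add' f g := by
    ext l
    match l with
    | [] => rfl
    | [false] => rfl
    | [true] => rfl
    | false :: false :: l => rfl
    | true :: true :: l => rfl
    | false :: true :: l => simp only [Pi.add_apply]; ring
    | true :: false :: l => simp only [Pi.add_apply]; ring
  map_smul' c f := by
    ext l
    match l with
    | [] => rfl
    | [false] => rfl
    | [true] => rfl
    | false :: false :: l => rfl
    | true :: true :: l => rfl
    | false :: true :: l => simp only [Pi.smul_apply, smul_eq_mul, RingHom.id_apply]; ring
    | true :: false :: l => simp only [Pi.smul_apply, smul_eq_mul, RingHom.id_apply]; ring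

section
variable (ω y z : ℂ) (f : List Bool → ℂ) (l : List Bool)

theorem columnExchange_singleton (s : Bool) : columnExchange ω y z f [s] = f [s] := by
  cases s <;> rfl
theorem columnExchange_same (s : Bool) :
    columnExchange ω y z f (s :: s :: l) = f (s :: s :: l) := by cases s <;> rfl
theorem columnExchange_false_true : columnExchange ω y z f (false :: true :: l) =
    ((1 - ω) * y * f (false :: true :: l) +
        (1 + ω) * (z - y) * f (true :: false :: l)) / (z - ω * y) := rfl
theorem columnExchange_true_false : columnExchange ω y z f (true :: false :: l) =
    ((1 + ω) * (z - y) * f (false :: true :: l) +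
        (1 - ω) * z * f (true :: false :: l)) / (z - ω * y) := rfl

end

/-- The Yang–Baxter equation. -/
theorem rowTransfer_columnExchange {ω : ℂ} (hω : ω ^ 2 + ω + 1 = 0) (x : ℂ) {y z : ℂ}
    (hyz : z - ω * y ≠ 0) (ys : List ℂ) (h : Bool) (f : List Bool → ℂ) (l : List Bool) :
    rowTransfer ω x (z :: y :: ys) h (columnExchange ω y z f) l =
      columnExchange ω y z (rowTransfer ω x (y :: z :: ys) h f) l := by
  match l with
  | [] => rfl
  | [s] => simp [rowTransfer, columnExchange_singleton]
  | s₁ :: s₂ :: l =>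
    have lin : ∀ (k : Bool) (a b c : ℂ) (g g' : List Bool → ℂ),
        rowTransfer ω x ys k (fun l' => (a * g l' + b * g' l') / c) l =
          (a * rowTransfer ω x ys k g l + b * rowTransfer ω x ys k g' l) / c := by
      intro k a b c g g'
      simp only [div_eq_inv_mul, rowTransfer_smul, rowTransfer_add]
    obtain ⟨G, hG⟩ : ∃ G : Bool → Bool → Bool → ℂ, ∀ k t₁ t₂,
        rowTransfer ω x ys k (fun l' => f (t₁ :: t₂ :: l')) l = G k t₁ t₂ := ⟨_, fun _ _ _ => rfl⟩
    have hω3 : ω ^ 3 = 1 := by linear_combination (ω - 1) * hω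
    cases s₁ <;> cases s₂ <;> cases h <;>
      simp only [columnExchange_same, columnExchange_false_true, columnExchange_true_false,
        rowTransfer_cons, Fintype.sum_bool, vertexWeight, lin, hG, zero_mul, zero_add, add_zero,
        one_mul] <;> field_simp <;> grind

/-- Operators for the permutations of the columns: they intertwine the transfer operators, and they
affect neither the lower boundary nor the value at the upper boundary. -/
theorem exists_intertwiner {ω : ℂ} (hω : ω ^ 2 + ω + 1 = 0) {ys ys' : List ℂ} (hp : ys.Perm ys')
    (hne : ∀ y ∈ ys, ∀ z ∈ ys, z - ω * y ≠ 0) :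
    ∃ R : (List Bool → ℂ) →ₗ[ℂ] (List Bool → ℂ), R allTrue = allTrue ∧
      (∀ f m, R f (List.replicate m false) = f (List.replicate m false)) ∧
      ∀ x h f, rowTransfer ω x ys' h (R f) = R (rowTransfer ω x ys h f) := by
  induction hp with
  | nil => exact ⟨LinearMap.id, rfl, fun _ _ => rfl, fun _ _ _ => rfl⟩
  | trans h₁ h₂ ih₁ ih₂ =>
    obtain ⟨R, hR₁, hR₂, hR₃⟩ := ih₁ hne
    obtain ⟨S, hS₁, hS₂, hS₃⟩ := ih₂ fun y hy z hz => hne y (h₁.mem_iff.2 hy) z (h₁.mem_iff.2 hz)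
    refine ⟨S ∘ₗ R, by simp [hR₁, hS₁], fun f m => by simp [hR₂, hS₂], fun x h f => ?_⟩
    simp only [LinearMap.comp_apply, hS₃, hR₃]
  | swap z y ys =>
    have hyz : z - ω * y ≠ 0 := hne y (by simp) z (by simp)
    refine ⟨columnExchange ω y z, ?_, fun f m => ?_, fun x h f =>
      funext fun l => rowTransfer_columnExchange hω x hyz ys h f l⟩
    · ext l
      match l with
      | [] => rfl
      | [s] => simp [columnExchange_singleton]
      | false :: false :: l => simp [columnExchange_same]
      | true :: true :: l => simp [columnExchange_same]
      | false :: true :: l => simp [columnExchange_false_true, allTrue]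
      | true :: false :: l => simp [columnExchange_true_false, allTrue]
    · match m with
      | 0 => rfl
      | 1 => rfl
      | m + 2 => exact columnExchange_same ω y z f _ false
  | @cons y l₁ l₂ _ ih =>
    obtain ⟨R, hR₁, hR₂, hR₃⟩ := ih fun a ha b hb =>
      hne a (List.mem_cons_of_mem _ ha) b (List.mem_cons_of_mem _ hb)
    let S : (List Bool → ℂ) →ₗ[ℂ] (List Bool → ℂ) :=
      { toFun := fun f l => match l with
          | [] => f []
          | s :: l => R (fun l' => f (s :: l')) l
        map_add' := fun f g => by
          ext l
          cases l with
          | nil => rfl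
          | cons s l => exact congrFun (R.map_add (fun l' => f (s :: l')) fun l' => g (s :: l')) l
        map_smul' := fun c f => by
          ext l
          cases l with
          | nil => rfl
          | cons s l => exact congrFun (R.map_smul c fun l' => f (s :: l')) l }
    -- `S` acts as `R` on all edges but the first.
    have S_cons : ∀ f s l, S f (s :: l) = R (fun l' => f (s :: l')) l := fun _ _ _ => rfl
    refine ⟨S, ?_, fun f m => ?_, fun x h f => ?_⟩
    · ext l
      match l with
      | [] => rfl
      | true :: l =>
        have : (fun l' => allTrue (true :: l')) = allTrue := by ext; simp [allTrue]
        rw [S_cons, this, hR₁]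
        simp [allTrue]
      | false :: l =>
        have : (fun l' => allTrue (false :: l')) = 0 := by ext; simp [allTrue]
        rw [S_cons, this, map_zero]
        simp [allTrue]
    · cases m with
      | zero => rfl
      | succ m => rw [List.replicate_succ, S_cons, hR₂]
    · ext l
      cases l with
      | nil => rfl
      | cons s l =>
        have : (fun l' => rowTransfer ω x (y :: l₁) h f (s :: l')) = ∑ k : Bool, ∑ t : Bool,
            vertexWeight ω x y h s k t • rowTransfer ω x l₁ k (fun l' => f (t :: l')) := by
          ext l'
          simp [rowTransfer_cons]
        rw [S_cons, this]
        simp only [S_cons, rowTransfer_cons, map_sum, map_smul, hR₃, Finset.sum_apply,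
          Pi.smul_apply, smul_eq_mul]

/-- The partition function with upper boundary `false` is symmetric in the column parameters. -/
theorem partitionFn_perm {ω : ℂ} (hω : ω ^ 2 + ω + 1 = 0) (xs : List ℂ) {ys ys' : List ℂ}
    (hp : ys.Perm ys') (hne : ∀ y ∈ ys, ∀ z ∈ ys, z - ω * y ≠ 0) (m : ℕ) :
    partitionFn ω xs ys' (List.replicate m false) =
      partitionFn ω xs ys (List.replicate m false) := by
  obtain ⟨R, hR₁, hR₂, hR₃⟩ := exists_intertwiner hω hp hne
  have h : partitionFn ω xs ys' = R (partitionFn ω xs ys) := by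
    induction xs with
    | nil => exact hR₁.symm
    | cons x xs ih => simp only [partitionFn, ih, hR₃]
  rw [h, hR₂]

/-! ### The partition function as a polynomial in the first row parameter -/

open Polynomial in
/-- Below an upper boundary of `false` edges, a row whose left edge is `true` has only the entry `0`,
and every weight has degree one. If the left edge is `false`, there is exactly one nonzero entry; it
is `1` and has constant weight, so the degree is lower by one. -/
theorem exists_polynomial_rowTransfer (ω : ℂ) (ys : List ℂ) (f : List Bool → ℂ) :
    (∃ p : ℂ[X], p.degree < (ys.length + 1 : ℕ) ∧
      ∀ x, p.eval x = rowTransfer ω x ys true f (List.replicate ys.length false)) ∧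
    ∃ p : ℂ[X], p.degree < ys.length ∧
      ∀ x, p.eval x = rowTransfer ω x ys false f (List.replicate ys.length false) := by
  induction ys generalizing f with
  | nil =>
    refine ⟨⟨C (f []), ?_, fun x => by simp [rowTransfer]⟩, 0, by simp, fun x => by
      simp [rowTransfer]⟩
    exact degree_C_le.trans_lt (by norm_num)
  | cons y ys ih =>
    have hlin : ∀ (a b : ℂ) (p : ℂ[X]) (n : ℕ), p.degree < (n : WithBot ℕ) →
        ((C a * X + C b) * p).degree < ((n + 1 : ℕ) : WithBot ℕ) := by
      intro a b p n hp
      rcases eq_or_ne p 0 with rfl | h0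
      · simp
      · rw [degree_eq_natDegree h0] at hp
        refine (degree_mul_le _ _).trans_lt ?_
        refine (add_le_add degree_linear_le (degree_eq_natDegree h0).le).trans_lt ?_
        have : p.natDegree < n := by exact_mod_cast hp
        have : 1 + p.natDegree < n + 1 := by omega
        exact_mod_cast this
    obtain ⟨⟨p, hp, hpx⟩, -⟩ := ih fun l => f (false :: l)
    obtain ⟨⟨q, hq, hqx⟩, -⟩ := ih fun l => f (true :: l)
    obtain ⟨-, r, hr, hrx⟩ := ih fun l => f (false :: l)
    refine ⟨⟨(C (-((2 + ω) / 3 * ω)) * X + C ((2 + ω) / 3 * y)) * p, hlin _ _ _ _ hp, fun x => ?_⟩,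
      (C ((2 + ω) / 3) * X + C (-((2 + ω) / 3 * (ω * y)))) * r + q,
      (degree_add_le _ _).trans_lt (max_lt (hlin _ _ _ _ hr) hq), fun x => ?_⟩
    · simp only [List.length_cons, List.replicate_succ, rowTransfer_cons, Fintype.sum_bool,
        vertexWeight, ← hpx, eval_mul, eval_add, eval_C, eval_X]
      ring
    · simp only [List.length_cons, List.replicate_succ, rowTransfer_cons, Fintype.sum_bool,
        vertexWeight, ← hqx, ← hrx, eval_mul, eval_add, eval_C, eval_X]
      ring

open Polynomial in
theorem exists_polynomial_partitionFn (ω : ℂ) (xs ys : List ℂ) :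
    ∃ p : ℂ[X], p.degree < ys.length ∧
      ∀ x, p.eval x = partitionFn ω (x :: xs) ys (List.replicate ys.length false) :=
  (exists_polynomial_rowTransfer ω ys (partitionFn ω xs ys)).2

/-! ### Freezing of the first row and the first column -/

theorem rowTransfer_false_true_cons (ω x y : ℂ) (ys : List ℂ) (f : List Bool → ℂ) (l : List Bool) :
    rowTransfer ω x (y :: ys) false f (true :: l) =
      (2 + ω) / 3 * (y - ω * x) * rowTransfer ω x ys false (fun l' => f (true :: l')) l := by
  simp [rowTransfer_cons, vertexWeight]

theorem rowTransfer_true_replicate (ω x : ℂ) (ys : List ℂ) (f : List Bool → ℂ) :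
    rowTransfer ω x ys true f (List.replicate ys.length false) =
      (ys.map fun y => (2 + ω) / 3 * (y - ω * x)).prod * f (List.replicate ys.length false) := by
  induction ys generalizing f with
  | nil => simp [rowTransfer]
  | cons y ys ih => simp [rowTransfer_cons, List.replicate_succ, vertexWeight, ih, mul_assoc]

/-- If the first vertical edge of the upper boundary is `true`, so is the whole first column. -/
theorem partitionFn_true_cons (ω : ℂ) (xs : List ℂ) (y : ℂ) (ys : List ℂ) (l : List Bool) :
    partitionFn ω xs (y :: ys) (true :: l) =
      (xs.map fun x => (2 + ω) / 3 * (y - ω * x)).prod * partitionFn ω xs ys l := by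
  induction xs generalizing l with
  | nil => simp [partitionFn, allTrue]
  | cons x xs ih =>
    simp only [partitionFn, rowTransfer_false_true_cons, ih, rowTransfer_smul, List.map_cons,
      List.prod_cons]
    ring

/-- At `x = ω * y` the weight of an entry `0` in the top left corner vanishes. The corner is
therefore `1`, which determines the first row and the first column. -/
theorem partitionFn_mul_cons (ω : ℂ) (xs : List ℂ) (y : ℂ) (ys : List ℂ) :
    partitionFn ω (ω * y :: xs) (y :: ys) (List.replicate (ys.length + 1) false) =
      (ys.map fun y' => (2 + ω) / 3 * (y' - ω * (ω * y))).prod *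
        (xs.map fun x => (2 + ω) / 3 * (y - ω * x)).prod *
        partitionFn ω xs ys (List.replicate ys.length false) := by
  simp [partitionFn, rowTransfer_cons, List.replicate_succ, vertexWeight,
    rowTransfer_true_replicate, partitionFn_true_cons, mul_assoc]

/-! ### Alternants -/

/-- The alternant of order `n` with exponents `e 0, e 1, …` at the points `z 0, …, z (n - 1)`. For
`e = id` it is the Vandermonde determinant. -/
noncomputable def alternant (e : ℕ → ℕ) (n : ℕ) (z : ℕ → ℂ) : ℂ :=
  (Matrix.of fun i j : Fin n => z i ^ e j).det

/-- The exponents `0, 1, 3, 4, 6, 7, …`: the natural numbers that are not `2` modulo `3`. -/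
def wheelExponent (j : ℕ) : ℕ := 3 * (j / 2) + j % 2

theorem wheelExponent_add_two (j : ℕ) : wheelExponent (j + 2) = wheelExponent j + 3 := by
  simp only [wheelExponent]
  omega

theorem alternant_eq_zero (e : ℕ → ℕ) {n : ℕ} {z : ℕ → ℂ} {i j : ℕ} (hi : i < n) (hj : j < n)
    (hij : i ≠ j) (h : z i = z j) : alternant e n z = 0 :=
  Matrix.det_zero_of_row_eq (i := ⟨i, hi⟩) (j := ⟨j, hj⟩) (by simpa using hij)
    (by ext k; simp [h])

theorem alternant_swap (e : ℕ → ℕ) {n : ℕ} (z : ℕ → ℂ) {i j : ℕ} (hi : i < n) (hj : j < n)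
    (hij : i ≠ j) : alternant e n (z ∘ Equiv.swap i j) = -alternant e n z := by
  have h := Matrix.det_permute (Equiv.swap (⟨i, hi⟩ : Fin n) ⟨j, hj⟩)
    (Matrix.of fun i j : Fin n => z i ^ e j)
  rw [Equiv.Perm.sign_swap (by simpa using hij)] at h
  have hval : ∀ a : Fin n, ((Equiv.swap (⟨i, hi⟩ : Fin n) ⟨j, hj⟩ a : Fin n) : ℕ) =
      Equiv.swap i j (a : ℕ) := by
    intro a
    simp only [Equiv.swap_apply_def, Fin.ext_iff]
    split_ifs <;> rfl
  simp only [alternant]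
  rw [show -(Matrix.of fun i j : Fin n => z i ^ e j).det =
    ((-1 : ℤˣ) : ℂ) * (Matrix.of fun i j : Fin n => z i ^ e j).det by simp, ← h]
  congr 1
  ext a b
  simp [hval]

open Polynomial in
theorem exists_polynomial_alternant (e : ℕ → ℕ) (n : ℕ) (z : ℕ → ℂ) {N : ℕ}
    (he : ∀ j ≤ n, e j ≤ N) :
    ∃ p : ℂ[X], p.natDegree ≤ N ∧
      ∀ u, p.eval u = alternant e (n + 1) (Function.update z 0 u) := by
  refine ⟨∑ j : Fin (n + 1), C ((-1) ^ (j : ℕ) * ((Matrix.of fun i j : Fin (n + 1) =>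
    z i ^ e j).submatrix Fin.succ j.succAbove).det) * X ^ e j,
    natDegree_sum_le_of_forall_le _ _ fun j _ =>
      (natDegree_C_mul_X_pow_le _ _).trans (he j (Nat.lt_succ_iff.1 j.2)), fun u => ?_⟩
  rw [alternant, Matrix.det_succ_row_zero, eval_finsetSum]
  refine Finset.sum_congr rfl fun j _ => ?_
  have : (Matrix.of fun i j : Fin (n + 1) => Function.update z 0 u i ^ e j).submatrix
      Fin.succ j.succAbove = (Matrix.of fun i j : Fin (n + 1) => z i ^ e j).submatrix
      Fin.succ j.succAbove := by
    ext a b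
    simp [Function.update_of_ne]
  rw [this]
  simp
  ring

theorem alternant_id_add_two (n : ℕ) (z : ℕ → ℂ) :
    alternant id (n + 2) z = (z 1 - z 0) * (∏ i ∈ Finset.range n,
      (z (i + 2) - z 0) * (z (i + 2) - z 1)) * alternant id n fun i => z (i + 2) := by
  have h : ∀ (m : ℕ) (w : ℕ → ℂ), alternant id m w =
      (Matrix.vandermonde fun i : Fin m => w i).det := fun _ _ => rfl
  rw [h, h, Matrix.det_vandermonde, Matrix.det_vandermonde, Fin.prod_univ_succ,
    Fin.prod_univ_succ, Fin.prod_Ioi_zero, Fin.prod_univ_succ, Finset.prod_mul_distrib,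
    Finset.prod_range fun i => z (i + 2) - z 0, Finset.prod_range fun i => z (i + 2) - z 1]
  simp only [Fin.prod_Ioi_succ, Fin.prod_Ioi_zero]
  simp
  ring

/-- Subtracting `z 0 ^ 3` times the column of the exponent `e j` from that of `e j + 3` makes the
matrix of the alternant block triangular. -/
theorem alternant_wheelExponent_add_two (n : ℕ) {z : ℕ → ℂ} (hz : z 1 ^ 3 = z 0 ^ 3) :
    alternant wheelExponent (n + 2) z = (z 1 - z 0) *
      (∏ i ∈ Finset.range n, (z (i + 2) ^ 3 - z 0 ^ 3)) *
      alternant wheelExponent n fun i => z (i + 2) := by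
  set c := z 0 ^ 3 with hc
  set A : Matrix (Fin (n + 2)) (Fin (n + 2)) ℂ := Matrix.of fun i j => z i ^ wheelExponent j
  let U : Matrix (Fin (n + 2)) (Fin (n + 2)) ℂ :=
    Matrix.of fun k j => (if k = j then 1 else 0) + if (k : ℕ) + 2 = j then -c else 0
  have hU : U.det = 1 := by
    rw [Matrix.det_of_isUpperTriangular]
    · simp [U]
    · intro i j hij
      have hij : (j : ℕ) < i := hij
      have h1 : i ≠ j := by rintro rfl; omega
      have h2 : ¬ (i : ℕ) + 2 = j := by omega
      simp [U, h1, h2]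
  have hAU0 : ∀ i j : Fin (n + 2), (j : ℕ) < 2 → (A * U) i j = A i j := by
    intro i j hj
    have : ∀ k : Fin (n + 2), ¬ (k : ℕ) + 2 = j := fun k => by omega
    simp [Matrix.mul_apply, U, this]
  have hAU2 : ∀ (i : Fin (n + 2)) (j : Fin n), (A * U) i (Fin.natAdd 2 j |>.cast (add_comm _ _)) =
      (z i ^ 3 - c) * z i ^ wheelExponent j := by
    intro i j
    have : ∀ k : Fin (n + 2), (k : ℕ) = j ↔ k = ⟨j, by omega⟩ := fun k => by rw [Fin.ext_iff]
    simp [Matrix.mul_apply, U, mul_add, Finset.sum_add_distrib, this, A,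
      wheelExponent_add_two]
    ring
  let σ : Fin 2 ⊕ Fin n ≃ Fin (n + 2) := finSumFinEquiv.trans (finCongr (add_comm _ _))
  have hblocks : (A * U).submatrix σ σ = Matrix.fromBlocks
      (Matrix.of fun i j : Fin 2 => z i ^ (j : ℕ)) 0
      (Matrix.of fun (i : Fin n) (j : Fin 2) => z (i + 2) ^ (j : ℕ))
      (Matrix.of fun i j : Fin n => (z (i + 2) ^ 3 - c) * z (i + 2) ^ wheelExponent j) := by
    have hw : ∀ j : Fin 2, wheelExponent j = j := by decide
    ext i j
    rcases i with i | i <;> rcases j with j | j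
    · rw [Matrix.submatrix_apply, hAU0 _ _ (by simp [σ]; omega)]
      simp [A, σ, hw]
    · refine (hAU2 _ j).trans ?_
      fin_cases i <;> simp [σ, hz, hc]
    · rw [Matrix.submatrix_apply, hAU0 _ _ (by simp [σ]; omega)]
      simp [A, σ, hw]
    · refine (hAU2 _ j).trans ?_
      simp [σ]
  calc alternant wheelExponent (n + 2) z = (A * U).det := by rw [Matrix.det_mul, hU, mul_one]; rfl
    _ = ((A * U).submatrix σ σ).det := (Matrix.det_submatrix_equiv_self σ _).symm
    _ = _ := by
      rw [hblocks, Matrix.det_fromBlocks_zero₁₂, Matrix.det_fin_two]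
      have := Matrix.det_mul_column (fun i : Fin n => z (i + 2) ^ 3 - c)
        (Matrix.of fun i j : Fin n => z (i + 2) ^ wheelExponent j)
      simp only [Matrix.of_apply] at this
      rw [this]
      simp [alternant, Finset.prod_range, mul_assoc]

/-! ### Evaluation of the partition function by interpolation -/

/-- The row parameters `z 0, z 2, …, z (2 * n - 2)`. -/
def evens (n : ℕ) (z : ℕ → ℂ) : List ℂ := (List.range n).map fun i => z (2 * i)

/-- The column parameters `z 1, z 3, …, z (2 * n - 1)`. -/
def odds (n : ℕ) (z : ℕ → ℂ) : List ℂ := (List.range n).map fun i => z (2 * i + 1)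

theorem length_odds (n : ℕ) (z : ℕ → ℂ) : (odds n z).length = n := by simp [odds]

theorem evens_succ (n : ℕ) (z : ℕ → ℂ) :
    evens (n + 1) z = z 0 :: evens n fun i => z (i + 2) := by
  simp [evens, List.range_succ_eq_map, Function.comp_def, mul_add]

theorem odds_succ (n : ℕ) (z : ℕ → ℂ) :
    odds (n + 1) z = z 1 :: odds n fun i => z (i + 2) := by
  simp [odds, List.range_succ_eq_map, Function.comp_def, mul_add, add_right_comm]

theorem prod_map_odds_mul_prod_map_evens (n : ℕ) (z : ℕ → ℂ) {f g h : ℂ → ℂ} {c : ℂ}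
    (hfgh : ∀ x y, g y * h x = c * (f x * f y)) :
    ((odds n z).map g).prod * ((evens n z).map h).prod =
      c ^ n * ∏ i ∈ Finset.range (2 * n), f (z i) := by
  induction n generalizing z with
  | zero => simp [evens, odds]
  | succ n ih =>
    rw [evens_succ, odds_succ, mul_add, Finset.prod_range_succ', Finset.prod_range_succ',
      List.map_cons, List.map_cons, List.prod_cons, List.prod_cons]
    linear_combination g (z 1) * h (z 0) * ih (fun i => z (i + 2)) +
      c ^ n * (∏ i ∈ Finset.range (2 * n), f (z (i + 2))) * hfgh (z 0) (z 1)

/-- Exchanging `z 1` and `z (2 * j + 1)` permutes the column parameters. -/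
theorem odds_swap_perm {n j : ℕ} (hj : j < n) (z : ℕ → ℂ) :
    (odds n (z ∘ Equiv.swap 1 (2 * j + 1))).Perm (odds n z) := by
  have h : odds n (z ∘ Equiv.swap 1 (2 * j + 1)) =
      ((List.range n).map (Equiv.swap 0 j)).map fun i => z (2 * i + 1) := by
    rw [List.map_map, odds]
    refine List.map_congr_left fun i _ => ?_
    simp only [Function.comp_apply, Equiv.swap_apply_def]
    congr 1
    split_ifs <;> omega
  rw [h]
  refine List.Perm.map _ ((List.perm_ext_iff_of_nodup
    (List.nodup_range.map (Equiv.injective _)) List.nodup_range).2 fun a => ?_)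
  simp only [List.mem_map, List.mem_range]
  constructor
  · rintro ⟨b, hb, rfl⟩
    rw [Equiv.swap_apply_def]
    split_ifs <;> omega
  · intro ha
    refine ⟨Equiv.swap 0 j a, ?_, Equiv.swap_apply_self _ _ _⟩
    rw [Equiv.swap_apply_def]
    split_ifs <;> omega

theorem im_ne_zero_of_root {ω : ℂ} (hω : ω ^ 2 + ω + 1 = 0) : ω.im ≠ 0 := by
  intro h
  have := congrArg Complex.re hω
  simp [pow_two, h] at this
  nlinarith [sq_nonneg (ω.re + 1 / 2)]

theorem ofReal_ne_mul {ω : ℂ} (hω : ω ^ 2 + ω + 1 = 0) (a : ℝ) {b : ℝ} (hb : 0 < b) :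
    (a : ℂ) ≠ ω * b := by
  intro h
  have := congrArg Complex.im h
  simp [im_ne_zero_of_root hω, hb.ne'] at this

/-- The inductive step of the evaluation at `z 0 = ω * z 1`. -/
theorem partitionFn_mul_alternant_of_eq_mul {ω : ℂ} (hω : ω ^ 2 + ω + 1 = 0) {n : ℕ} {z : ℕ → ℂ}
    {c : ℂ} (hz : z 0 = ω * z 1)
    (ih : partitionFn ω (evens n fun i => z (i + 2)) (odds n fun i => z (i + 2))
        (List.replicate n false) * alternant id (2 * n) (fun i => z (i + 2)) =
      c * alternant wheelExponent (2 * n) fun i => z (i + 2)) :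
    partitionFn ω (evens (n + 1) z) (odds (n + 1) z) (List.replicate (n + 1) false) *
        alternant id (2 * (n + 1)) z =
      (1 / 3) ^ n * c * alternant wheelExponent (2 * (n + 1)) z := by
  have hω3 : ω ^ 3 = 1 := by linear_combination (ω - 1) * hω
  have hZ := partitionFn_mul_cons ω (evens n fun i => z (i + 2)) (z 1) (odds n fun i => z (i + 2))
  simp only [length_odds] at hZ
  rw [mul_add, mul_one, alternant_id_add_two, alternant_wheelExponent_add_two _
    (by rw [hz, mul_pow, hω3, one_mul]), evens_succ, odds_succ, hz, hZ]
  have hω2 : ω ^ 2 = -ω - 1 := by linear_combination hω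
  have hw : ∏ i ∈ Finset.range (2 * n), (z (i + 2) ^ 3 - (ω * z 1) ^ 3) =
      (∏ i ∈ Finset.range (2 * n), (z (i + 2) - ω ^ 2 * z 1)) *
        ∏ i ∈ Finset.range (2 * n), ((z (i + 2) - ω * z 1) * (z (i + 2) - z 1)) := by
    rw [← Finset.prod_mul_distrib]
    refine Finset.prod_congr rfl fun i _ => ?_
    grind
  have hκ := prod_map_odds_mul_prod_map_evens n (fun i => z (i + 2))
    (f := fun w => w - ω ^ 2 * z 1) (g := fun y => (2 + ω) / 3 * (y - ω * (ω * z 1)))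
    (h := fun x => (2 + ω) / 3 * (z 1 - ω * x)) (c := 1 / 3) fun x y => by grind
  rw [hw]
  generalize ∏ i ∈ Finset.range (2 * n), ((z (i + 2) - ω * z 1) * (z (i + 2) - z 1)) = q at *
  linear_combination (z 1 - ω * z 1) * q * (partitionFn ω (evens n fun i => z (i + 2))
      (odds n fun i => z (i + 2)) (List.replicate n false) *
        alternant id (2 * n) (fun i => z (i + 2))) * hκ +
    (z 1 - ω * z 1) * q * (1 / 3) ^ n *
    (∏ i ∈ Finset.range (2 * n), (z (i + 2) - ω ^ 2 * z 1)) * ih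

open Polynomial in
/-- Both sides are polynomials in `z 0` of degree at most `3 * n + 1`. They agree at the `2 * n + 1`
points `z i`, where the alternants vanish, and at the `n + 1` points `ω * z (2 * j + 1)`. -/
theorem partitionFn_mul_alternant {ω : ℂ} (hω : ω ^ 2 + ω + 1 = 0) (n : ℕ) (z : ℕ → ℝ)
    (hz : Function.Injective z) (hpos : ∀ i, 0 < z i) :
    partitionFn ω (evens n fun i => z i) (odds n fun i => z i) (List.replicate n false) *
        alternant id (2 * n) (fun i => z i) =
      (∏ k ∈ Finset.range n, (1 / 3) ^ k) * alternant wheelExponent (2 * n) fun i => z i := by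
  induction n generalizing z with
  | zero => simp [evens, odds, partitionFn, allTrue, alternant]
  | succ n ih =>
    set c : ℂ := ∏ k ∈ Finset.range (n + 1), (1 / 3) ^ k with hc
    have hwheel : ∀ w : ℕ → ℝ, Function.Injective w → (∀ i, 0 < w i) →
        partitionFn ω (ω * w 1 :: evens n fun i => w (i + 2)) (odds (n + 1) fun i => w i)
          (List.replicate (n + 1) false) *
          alternant id (2 * (n + 1)) (Function.update (fun i => (w i : ℂ)) 0 (ω * w 1)) =
        c * alternant wheelExponent (2 * (n + 1))
          (Function.update (fun i => (w i : ℂ)) 0 (ω * w 1)) := by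
      intro w hw hwpos
      have := partitionFn_mul_alternant_of_eq_mul hω
        (z := Function.update (fun i => (w i : ℂ)) 0 (ω * w 1)) (by simp)
        (ih (fun i => w (i + 2)) (fun a b h => by simpa using hw h) fun i => hwpos _)
      rw [hc, Finset.prod_range_succ, mul_comm (∏ k ∈ Finset.range n, (1 / 3 : ℂ) ^ k), ← this,
        evens_succ, odds_succ, odds_succ]
      simp
    -- Exchanging `z 1` and `z (2 * j + 1)` fixes the partition function and changes the sign of both
    -- alternants.
    have hswap : ∀ j < n + 1,
        partitionFn ω (ω * z (2 * j + 1) :: evens n fun i => z (i + 2)) (odds (n + 1) fun i => z i)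
          (List.replicate (n + 1) false) *
          alternant id (2 * (n + 1))
            (Function.update (fun i => (z i : ℂ)) 0 (ω * z (2 * j + 1))) =
        c * alternant wheelExponent (2 * (n + 1))
          (Function.update (fun i => (z i : ℂ)) 0 (ω * z (2 * j + 1))) := by
      intro j hj
      rcases Nat.eq_zero_or_pos j with rfl | hj0
      · exact hwheel z hz hpos
      have h := hwheel (z ∘ Equiv.swap 1 (2 * j + 1)) (hz.comp (Equiv.injective _))
        fun i => hpos _
      have hupd : Function.update (fun i => ((z ∘ Equiv.swap 1 (2 * j + 1)) i : ℂ)) 0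
          (ω * (z ∘ Equiv.swap 1 (2 * j + 1)) 1) =
          Function.update (fun i => (z i : ℂ)) 0 (ω * z (2 * j + 1)) ∘
            Equiv.swap 1 (2 * j + 1) := by
        ext i
        by_cases hi : i = 0
        · subst hi
          simp [Equiv.swap_apply_of_ne_of_ne (show (0 : ℕ) ≠ 1 by omega)
            (show 0 ≠ 2 * j + 1 by omega)]
        · have : Equiv.swap 1 (2 * j + 1) i ≠ 0 := by
            rw [Equiv.swap_apply_def]
            split_ifs <;> omega
          simp [hi, this]
      have hev : (evens n fun i => ((z ∘ Equiv.swap 1 (2 * j + 1)) (i + 2) : ℂ)) =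
          evens n fun i => (z (i + 2) : ℂ) := by
        refine List.map_congr_left fun i _ => ?_
        simp only [Function.comp_apply]
        rw [Equiv.swap_apply_of_ne_of_ne] <;> omega
      have hodd := partitionFn_perm hω (ω * z (2 * j + 1) :: evens n fun i => (z (i + 2) : ℂ))
        (odds_swap_perm hj fun i => (z i : ℂ)).symm (fun y hy y' hy' => by
          simp only [odds, List.mem_map] at hy hy'
          obtain ⟨a, -, rfl⟩ := hy
          obtain ⟨b, -, rfl⟩ := hy'
          exact sub_ne_zero.2 (ofReal_ne_mul hω _ (hpos _))) (n + 1)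
      rw [hupd, alternant_swap _ _ (by omega) (by omega) (by omega),
        alternant_swap _ _ (by omega) (by omega) (by omega), hev] at h
      simp only [Function.comp_apply, Equiv.swap_apply_left] at h hodd
      rw [← hodd]
      simp only [Function.comp_def]
      linear_combination -h
    obtain ⟨p, hp, hpu⟩ := exists_polynomial_partitionFn ω (evens n fun i => (z (i + 2) : ℂ))
      (odds (n + 1) fun i => (z i : ℂ))
    obtain ⟨v, hv, hvu⟩ := exists_polynomial_alternant id (2 * n + 1) (fun i => (z i : ℂ))
      (N := 2 * n + 1) fun j hj => hj
    obtain ⟨d, hd, hdu⟩ := exists_polynomial_alternant wheelExponent (2 * n + 1)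
      (fun i => (z i : ℂ)) (N := 3 * n + 1) fun j hj => by
        simp only [wheelExponent]
        omega
    rw [length_odds] at hp hpu
    have hp' : p.natDegree ≤ n := by
      rcases eq_or_ne p 0 with rfl | h0
      · simp
      · rw [degree_eq_natDegree h0] at hp
        exact Nat.lt_succ_iff.1 (by exact_mod_cast hp)
    have hdeg : (p * v - C c * d).natDegree ≤ 3 * n + 1 :=
      (natDegree_sub_le _ _).trans (max_le (natDegree_mul_le.trans (by omega))
        ((natDegree_C_mul_le _ _).trans hd))
    let F : Fin (2 * n + 1) ⊕ Fin (n + 1) → ℂ :=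
      Sum.elim (fun i => z (i + 1)) fun j => ω * z (2 * j + 1)
    have hω0 : ω ≠ 0 := fun h => im_ne_zero_of_root hω (by simp [h])
    have hF : Function.Injective F := by
      refine Function.Injective.sumElim (fun a b h => ?_) (fun a b h => ?_) fun a b =>
        ofReal_ne_mul hω _ (hpos _)
      · have := hz (Complex.ofReal_injective h)
        exact Fin.ext (by omega)
      · have := hz (Complex.ofReal_injective (mul_left_cancel₀ hω0 h))
        exact Fin.ext (by omega)
    have hzero := eq_zero_of_natDegree_lt_card_of_eval_eq_zero (p * v - C c * d) hF (by
      intro a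
      rw [eval_sub, eval_mul, eval_mul, eval_C, hpu, hvu, hdu, sub_eq_zero]
      rcases a with i | j
      · have hvan : ∀ e, alternant e (2 * n + 1 + 1)
            (Function.update (fun i => (z i : ℂ)) 0 (z (i + 1))) = 0 := fun e =>
          alternant_eq_zero e (i := 0) (j := i + 1) (by omega) (by omega) (by omega) (by simp)
        simp [F, hvan]
      · exact hswap j j.2) (by
      simp only [Fintype.card_sum, Fintype.card_fin]
      omega)
    have h := congrArg (eval (z 0 : ℂ)) hzero
    rw [eval_sub, eval_mul, eval_mul, eval_C, hpu, hvu, hdu, eval_zero, sub_eq_zero,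
      Function.update_eq_self] at h
    rw [evens_succ]
    exact h

/-! ### Specialization at a geometric progression and the limit at `1` -/

theorem prod_prod_Ioi {M : Type*} [CommMonoid M] (n : ℕ) (f : ℕ → ℕ → M) :
    ∏ i : Fin n, ∏ j ∈ Finset.Ioi i, f i j =
      ∏ j ∈ Finset.range n, ∏ i ∈ Finset.range j, f i j := by
  rw [Finset.prod_comm' (t' := Finset.univ) (s' := fun j => Finset.Iio j) (by simp),
    Finset.prod_range]
  refine Finset.prod_congr rfl fun j _ => ?_
  rw [← Nat.Iio_eq_range, ← Fin.map_valEmbedding_Iio, Finset.prod_map]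
  rfl

theorem alternant_geometric (e : ℕ → ℕ) (n : ℕ) (t : ℂ) :
    alternant e n (fun i => t ^ i) =
      ∏ j ∈ Finset.range n, ∏ i ∈ Finset.range j, (t ^ e j - t ^ e i) := by
  rw [← prod_prod_Ioi n fun i j => t ^ e j - t ^ e i,
    ← Matrix.det_vandermonde fun i : Fin n => t ^ e i, ← Matrix.det_transpose]
  refine congrArg Matrix.det ?_
  ext i j
  simp [Matrix.vandermonde, ← pow_mul, mul_comm]

/-- The alternant at a geometric progression with ratio `t` is a power of `t - 1` that depends only
on `n`, times a product that is regular and nonzero at `t = 1`. -/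
theorem alternant_geometric_eq_mul {e : ℕ → ℕ} (he : Monotone e) (n : ℕ) (t : ℂ) :
    alternant e n (fun i => t ^ i) =
      (∏ j ∈ Finset.range n, ∏ _i ∈ Finset.range j, (t - 1)) *
        ∏ j ∈ Finset.range n, ∏ i ∈ Finset.range j,
          (t ^ e i * ∑ k ∈ Finset.range (e j - e i), t ^ k) := by
  simp only [alternant_geometric, ← Finset.prod_mul_distrib]
  refine Finset.prod_congr rfl fun j _ => Finset.prod_congr rfl fun i hi => ?_
  have hij : e i ≤ e j := he (Finset.mem_range.1 hi).le
  rw [mul_left_comm, mul_geom_sum, mul_sub, mul_one, ← pow_add, Nat.add_sub_cancel' hij]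

theorem continuous_rowTransfer {ι : Type*} (ω : ℂ) {x : ℝ → ℂ} (hx : Continuous x)
    {φ : ι → ℝ → ℂ} (hφ : ∀ i, Continuous (φ i)) (I : List ι) (h : Bool)
    {f : ℝ → List Bool → ℂ} (hf : ∀ l, Continuous fun t => f t l) (l : List Bool) :
    Continuous fun t => rowTransfer ω (x t) (I.map fun i => φ i t) h (f t) l := by
  induction I generalizing h f l with
  | nil =>
    cases h
    · simpa [rowTransfer] using continuous_const
    · simpa [rowTransfer] using hf l
  | cons i I ih =>
    cases l with
    | nil => exact continuous_const
    | cons s l =>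
      simp only [List.map_cons, rowTransfer_cons]
      refine continuous_finsetSum _ fun k _ => continuous_finsetSum _ fun t _ =>
        Continuous.mul ?_ (ih k (fun l' => hf (t :: l')) l)
      have := hφ i
      cases h <;> cases s <;> cases k <;> cases t <;> simp only [vertexWeight] <;> fun_prop

theorem continuous_partitionFn {ι κ : Type*} (ω : ℂ) {ψ : κ → ℝ → ℂ} (hψ : ∀ i, Continuous (ψ i))
    {φ : ι → ℝ → ℂ} (hφ : ∀ i, Continuous (φ i)) (K : List κ) (I : List ι) (l : List Bool) :
    Continuous fun t => partitionFn ω (K.map fun i => ψ i t) (I.map fun i => φ i t) l := by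
  induction K generalizing l with
  | nil => exact continuous_const
  | cons k K ih => exact continuous_rowTransfer ω (hψ k) hφ I false ih l

theorem monotone_wheelExponent : Monotone wheelExponent := fun a b h => by
  simp only [wheelExponent]
  omega

/-- The limit of `partitionFn_mul_alternant` as `z i = t ^ i` tends to `1`, after division by the
common power of `t - 1` of the two alternants. -/
theorem partitionFn_one_mul {ω : ℂ} (hω : ω ^ 2 + ω + 1 = 0) (n : ℕ) :
    partitionFn ω (List.replicate n 1) (List.replicate n 1) (List.replicate n false) *
        ∏ j ∈ Finset.range (2 * n), ∏ i ∈ Finset.range j, ((j : ℂ) - i) =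
      (∏ k ∈ Finset.range n, (1 / 3) ^ k) *
        ∏ j ∈ Finset.range (2 * n), ∏ i ∈ Finset.range j,
          ((wheelExponent j : ℂ) - wheelExponent i) := by
  let g : (ℕ → ℕ) → ℝ → ℂ := fun e t => ∏ j ∈ Finset.range (2 * n), ∏ i ∈ Finset.range j,
    ((t : ℂ) ^ e i * ∑ k ∈ Finset.range (e j - e i), (t : ℂ) ^ k)
  have hg : ∀ e, Continuous (g e) := fun e => by
    simp only [g]
    fun_prop
  have hg1 : ∀ e, Monotone e → g e 1 =
      ∏ j ∈ Finset.range (2 * n), ∏ i ∈ Finset.range j, ((e j : ℂ) - e i) := by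
    intro e he
    refine Finset.prod_congr rfl fun j _ => Finset.prod_congr rfl fun i hi => ?_
    rw [← Nat.cast_sub (he (Finset.mem_range.1 hi).le)]
    simp
  let Z : ℝ → ℂ := fun t => partitionFn ω (evens n fun i => (t : ℂ) ^ i)
    (odds n fun i => (t : ℂ) ^ i) (List.replicate n false)
  have hZ : Continuous Z := continuous_partitionFn ω (ψ := fun i t => (t : ℂ) ^ (2 * i))
    (φ := fun i t => (t : ℂ) ^ (2 * i + 1)) (fun _ => by fun_prop) (fun _ => by fun_prop) _ _ _
  have hZ1 : Z 1 = partitionFn ω (List.replicate n 1) (List.replicate n 1)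
      (List.replicate n false) := by
    simp [Z, evens, odds, List.map_const']
  have heq : ∀ t ∈ Set.Ioi (1 : ℝ), Z t * g id t =
      (∏ k ∈ Finset.range n, (1 / 3) ^ k) * g wheelExponent t := by
    intro t ht
    have ht : 1 < t := ht
    have h := partitionFn_mul_alternant hω n (fun i => t ^ i)
      (pow_right_strictMono₀ ht).injective fun i => by positivity
    simp only [Complex.ofReal_pow] at h
    rw [alternant_geometric_eq_mul monotone_id, alternant_geometric_eq_mul monotone_wheelExponent,
      mul_left_comm, mul_left_comm (∏ k ∈ Finset.range n, _)] at h
    refine mul_left_cancel₀ ?_ h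
    have ht1 : (t : ℂ) - 1 ≠ 0 := sub_ne_zero.2 (by exact_mod_cast ht.ne')
    exact Finset.prod_ne_zero_iff.2 fun _ _ => Finset.prod_ne_zero_iff.2 fun _ _ => ht1
  have h1 : Set.EqOn (fun t => Z t * g id t)
      (fun t => (∏ k ∈ Finset.range n, (1 / 3) ^ k) * g wheelExponent t)
      (closure (Set.Ioi 1)) :=
    Set.EqOn.closure heq (hZ.mul (hg _)) (continuous_const.mul (hg _))
  have h2 := h1 (show (1 : ℝ) ∈ closure (Set.Ioi 1) by simp)
  simp only [hZ1, hg1 _ monotone_id, hg1 _ monotone_wheelExponent] at h2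
  exact h2

/-! ### The product formula -/

theorem prod_range_sub_eq_factorial (m : ℕ) :
    ∏ i ∈ Finset.range m, ((m : ℂ) - i) = (m.factorial : ℂ) := by
  induction m with
  | zero => simp
  | succ m ih =>
    rw [Finset.prod_range_succ', Nat.factorial_succ]
    simp only [Nat.cast_add, Nat.cast_one, add_sub_add_right_eq_sub, ih, Nat.cast_mul]
    simp [mul_comm]

/-- The two new factors in passing from `2 * n` to `2 * n + 2` exponents, which are `3 * n` and
`3 * n + 1`. -/
theorem prod_sub_wheelExponent (n : ℕ) :
    (∏ i ∈ Finset.range (2 * n), (3 * n - wheelExponent i : ℂ)) *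
        ∏ i ∈ Finset.range (2 * n + 1), (3 * n + 1 - wheelExponent i : ℂ) =
      3 ^ n * n.factorial * (3 * n + 1).factorial := by
  induction n with
  | zero => simp [wheelExponent]
  | succ n ih =>
    have h0 : wheelExponent 0 = 0 := rfl
    have h1 : wheelExponent 1 = 1 := rfl
    have e1 : ∀ i, (3 * ((n + 1 : ℕ) : ℂ) - wheelExponent (i + 1 + 1)) =
        3 * n - wheelExponent i := fun i => by
      rw [wheelExponent_add_two]
      push_cast
      ring
    have e2 : ∀ i, (3 * ((n + 1 : ℕ) : ℂ) + 1 - wheelExponent (i + 1 + 1)) =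
        3 * n + 1 - wheelExponent i := fun i => by
      rw [wheelExponent_add_two]
      push_cast
      ring
    rw [show 2 * (n + 1) + 1 = 2 * n + 1 + 1 + 1 by ring, show 2 * (n + 1) = 2 * n + 1 + 1 by ring,
      Finset.prod_range_succ', Finset.prod_range_succ' _ (2 * n), Finset.prod_range_succ',
      Finset.prod_range_succ' _ (2 * n + 1)]
    simp only [e1, e2, h0, h1, zero_add]
    rw [show 3 * (n + 1) + 1 = 3 * n + 1 + 1 + 1 + 1 by ring, Nat.factorial_succ (3 * n + 1 + 1 + 1),
      Nat.factorial_succ (3 * n + 1 + 1), Nat.factorial_succ (3 * n + 1), Nat.factorial_succ n]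
    push_cast
    linear_combination (3 * (n + 1 : ℂ) - 1) * (3 * (n + 1 : ℂ)) * (3 * (n + 1 : ℂ) + 1) *
      (3 * (n + 1 : ℂ)) * ih

theorem prod_wheelExponent_mul (n : ℕ) :
    (∏ k ∈ Finset.range n, (1 / 3 : ℂ) ^ k) *
        (∏ j ∈ Finset.range (2 * n), ∏ i ∈ Finset.range j,
          ((wheelExponent j : ℂ) - wheelExponent i)) *
        ∏ k ∈ Finset.range n, ((n + k).factorial : ℂ) =
      (∏ k ∈ Finset.range n, ((3 * k + 1).factorial : ℂ)) *
        ∏ j ∈ Finset.range (2 * n), ∏ i ∈ Finset.range j, ((j : ℂ) - i) := by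
  induction n with
  | zero => simp
  | succ n ih =>
    have hfac : (n.factorial : ℂ) * ∏ k ∈ Finset.range (n + 1), ((n + 1 + k).factorial : ℂ) =
        (∏ k ∈ Finset.range n, ((n + k).factorial : ℂ)) * (2 * n).factorial *
          (2 * n + 1).factorial := by
      have h : ∏ k ∈ Finset.range (n + 1), ((n + k).factorial : ℂ) =
          (∏ k ∈ Finset.range n, ((n + 1 + k).factorial : ℂ)) * n.factorial := by
        rw [Finset.prod_range_succ']
        simp only [add_zero, add_assoc, add_comm 1]
      rw [Finset.prod_range_succ] at h
      rw [Finset.prod_range_succ, show n + 1 + n = 2 * n + 1 by ring,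
        show 2 * n = n + n by ring] at *
      linear_combination -((n + n + 1).factorial : ℂ) * h
    have hw0 : (wheelExponent (2 * n) : ℂ) = 3 * n := by
      have : wheelExponent (2 * n) = 3 * n := by simp only [wheelExponent]; omega
      exact_mod_cast this
    have hw1 : (wheelExponent (2 * n + 1) : ℂ) = 3 * n + 1 := by
      have : wheelExponent (2 * n + 1) = 3 * n + 1 := by simp only [wheelExponent]; omega
      exact_mod_cast this
    have hn : (n.factorial : ℂ) ≠ 0 := by exact_mod_cast n.factorial_ne_zero
    have h3 : (1 / 3 : ℂ) ^ n * 3 ^ n = 1 := by rw [← mul_pow]; norm_num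
    have hs := prod_sub_wheelExponent n
    refine mul_left_cancel₀ hn ?_
    have hP : ∏ j ∈ Finset.range (2 * (n + 1)), ∏ i ∈ Finset.range j,
        ((wheelExponent j : ℂ) - wheelExponent i) = (∏ j ∈ Finset.range (2 * n),
          ∏ i ∈ Finset.range j, ((wheelExponent j : ℂ) - wheelExponent i)) *
          (3 ^ n * n.factorial * (3 * n + 1).factorial) := by
      rw [← hs, show 2 * (n + 1) = 2 * n + 1 + 1 by ring, Finset.prod_range_succ,
        Finset.prod_range_succ, hw0, hw1, mul_assoc]
    have hQ : ∏ j ∈ Finset.range (2 * (n + 1)), ∏ i ∈ Finset.range j, ((j : ℂ) - i) =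
        (∏ j ∈ Finset.range (2 * n), ∏ i ∈ Finset.range j, ((j : ℂ) - i)) *
          (2 * n).factorial * (2 * n + 1).factorial := by
      rw [← prod_range_sub_eq_factorial, ← prod_range_sub_eq_factorial,
        show 2 * (n + 1) = 2 * n + 1 + 1 by ring, Finset.prod_range_succ, Finset.prod_range_succ]
    rw [hP, hQ, Finset.prod_range_succ (fun k => (1 / 3 : ℂ) ^ k),
      Finset.prod_range_succ fun k => ((3 * k + 1).factorial : ℂ)]
    set P := ∏ j ∈ Finset.range (2 * n), ∏ i ∈ Finset.range j,
      ((wheelExponent j : ℂ) - wheelExponent i)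
    set K := ∏ k ∈ Finset.range n, (1 / 3 : ℂ) ^ k
    linear_combination K * (1 / 3) ^ n * P * (3 ^ n * n.factorial * (3 * n + 1).factorial) * hfac +
      n.factorial * (3 * n + 1).factorial * (2 * n).factorial * (2 * n + 1).factorial * ih +
      n.factorial * (3 * n + 1).factorial * (2 * n).factorial * (2 * n + 1).factorial * K * P *
        (∏ k ∈ Finset.range n, ((n + k).factorial : ℂ)) * h3

theorem partitionFn_one {ω : ℂ} (hω : ω ^ 2 + ω + 1 = 0) (n : ℕ) :
    partitionFn ω (List.replicate n 1) (List.replicate n 1) (List.replicate n false) =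
      (∏ k ∈ Finset.range n, ((3 * k + 1).factorial : ℂ)) /
        ∏ k ∈ Finset.range n, ((n + k).factorial : ℂ) := by
  have h0 : ∏ j ∈ Finset.range (2 * n), ∏ i ∈ Finset.range j, ((j : ℂ) - i) ≠ 0 := by
    simp only [prod_range_sub_eq_factorial]
    exact Finset.prod_ne_zero_iff.2 fun j _ => by exact_mod_cast j.factorial_ne_zero
  have h1 : ∏ k ∈ Finset.range n, ((n + k).factorial : ℂ) ≠ 0 :=
    Finset.prod_ne_zero_iff.2 fun k _ => by exact_mod_cast (n + k).factorial_ne_zero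
  rw [eq_div_iff h1]
  refine mul_right_cancel₀ h0 ?_
  rw [mul_right_comm, partitionFn_one_mul hω, prod_wheelExponent_mul]

/-! ### Alternating sign matrices as states of the six-vertex model -/

/-- The partial sums of `v`, starting from `h`, stay in `{0, 1}` and end at `1`. Here `false` and
`true` stand for the values `0` and `1` of a partial sum. -/
def IsWalk : (n : ℕ) → Bool → (Fin n → ℤ) → Prop
  | 0, h, _ => h = true
  | n + 1, h, v => ∃ k : Bool, h.toInt + v 0 = k.toInt ∧ IsWalk n k fun i => v i.succ

theorem Bool.toInt_injective : Function.Injective Bool.toInt := by decide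

/-- An alternating sequence, preceded by `-1` if `h = false` and by `1` if `h = true`. -/
structure IsAlternatingAfter {n : ℕ} (h : Bool) (v : Fin n → ℤ) : Prop where
  entries : ∀ i, v i = 0 ∨ v i = 1 ∨ v i = -1
  exists_ne_zero : h = false → ∃ i, v i ≠ 0
  first_eq : ∀ i, v i ≠ 0 → (∀ j, j < i → v j = 0) → v i = 1 - 2 * h.toInt
  last_eq_one : ∀ i, v i ≠ 0 → (∀ j, i < j → v j = 0) → v i = 1
  alternate : ∀ i j, i < j → v i ≠ 0 → v j ≠ 0 → (∀ k, i < k → k < j → v k = 0) → v j = -v i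

theorem isAlternatingAfter_succ {n : ℕ} (h : Bool) (v : Fin (n + 1) → ℤ) :
    IsAlternatingAfter h v ↔
      ∃ k : Bool, h.toInt + v 0 = k.toInt ∧ IsAlternatingAfter k fun i => v i.succ := by
  constructor
  · rintro ⟨h1, h2, h3, h4, h5⟩
    simp only [Fin.forall_fin_succ, Fin.exists_fin_succ, Fin.succ_lt_succ_iff, Fin.succ_pos,
      lt_irrefl, Fin.not_lt_zero, IsEmpty.forall_iff, forall_const, true_and, implies_true] at *
    by_cases h0 : v 0 = 0
    · refine ⟨h, by simp [h0], h1.2, ?_, ?_, h4.2, ?_⟩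
      all_goals grind
    · refine ⟨!h, ?_, h1.2, ?_, ?_, h4.2, ?_⟩
      all_goals cases h <;> simp at * <;> grind
  · rintro ⟨k, hk, ⟨h1, h2, h3, h4, h5⟩⟩
    have hv : v 0 = k.toInt - h.toInt := by linarith
    constructor
    all_goals
      simp only [Fin.forall_fin_succ, Fin.exists_fin_succ, Fin.succ_lt_succ_iff, Fin.succ_pos,
        lt_irrefl, Fin.not_lt_zero, IsEmpty.forall_iff, forall_const, true_and, implies_true]
    · exact ⟨by cases h <;> cases k <;> simp [hv], h1⟩
    · rintro rfl
      cases k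
      · exact Or.inr (h2 rfl)
      · exact Or.inl (by simp [hv])
    · refine ⟨fun h0 => ?_, fun i hi h0 => ?_⟩
      · cases h <;> cases k <;> simp only [Bool.toInt_true, Bool.toInt_false] at hv ⊢ <;> omega
      · have hkh : k = h := Bool.toInt_injective (by have := h0.1; omega)
        exact hkh ▸ h3 i hi h0.2
    · refine ⟨fun h0 hall => ?_, h4⟩
      cases k
      · obtain ⟨i, hi⟩ := h2 rfl
        exact absurd (hall i) hi
      · cases h <;> simp only [Bool.toInt_true, Bool.toInt_false] at hv <;> omega
    · refine ⟨fun i h0 hi hall => ?_, h5⟩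
      rw [h3 i hi hall]
      cases h <;> cases k <;> simp only [Bool.toInt_true, Bool.toInt_false] at hv ⊢ <;> omega

theorem isAlternatingAfter_iff_isWalk {n : ℕ} (h : Bool) (v : Fin n → ℤ) :
    IsAlternatingAfter h v ↔ IsWalk n h v := by
  induction n generalizing h with
  | zero =>
    refine ⟨fun hv => ?_, fun hv => ⟨fun i => i.elim0, fun h0 => ?_, fun i => i.elim0,
      fun i => i.elim0, fun i => i.elim0⟩⟩
    · by_contra h0
      obtain ⟨i, -⟩ := hv.exists_ne_zero (by simpa [IsWalk] using h0)
      exact i.elim0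
    · rw [IsWalk, h0] at hv
      cases hv
  | succ n ih => simp only [isAlternatingAfter_succ, ih, IsWalk]

theorem isAlternatingSeq_iff_isWalk {n : ℕ} (v : Fin n → ℤ) :
    IsAlternatingSeq v ↔ IsWalk n false v := by
  rw [← isAlternatingAfter_iff_isWalk]
  exact ⟨fun ⟨h1, h2, h3, h4, h5⟩ => ⟨h1, fun _ => h2, by simpa using h3, h4, h5⟩,
    fun ⟨h1, h2, h3, h4, h5⟩ => ⟨h1, h2 rfl, by simpa using h3, h4, h5⟩⟩

open Classical in
/-- The matrices whose rows are alternating sequences and whose partial column sums, starting from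
the entries of `s`, stay in `{0, 1}` and end at `1`. The recursion chooses the partial column sums
`t` below the first row. -/
noncomputable def walkMatrices (m : ℕ) : (k : ℕ) → (Fin m → Bool) → Finset (Fin k → Fin m → ℤ)
  | 0, s => if s = fun _ => true then {fun i => i.elim0} else ∅
  | k + 1, s => (Finset.univ.filter fun t : Fin m → Bool =>
      IsWalk m false fun j => (t j).toInt - (s j).toInt).biUnion fun t =>
        (walkMatrices m k t).image (Fin.cons fun j => (t j).toInt - (s j).toInt)

theorem mem_walkMatrices {m k : ℕ} {s : Fin m → Bool} {A : Fin k → Fin m → ℤ} :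
    A ∈ walkMatrices m k s ↔
      (∀ i, IsWalk m false (A i)) ∧ ∀ j, IsWalk k (s j) fun i => A i j := by
  induction k generalizing s with
  | zero =>
    have hA : A = fun i => i.elim0 := Subsingleton.elim _ _
    by_cases hs : s = fun _ => true
    · simp [walkMatrices, IsWalk, hs, hA]
    · have : ∃ j, s j ≠ true := by
        by_contra! h
        exact hs (funext h)
      simpa [walkMatrices, IsWalk, hs] using this
  | succ k ih =>
    simp only [walkMatrices, Finset.mem_biUnion, Finset.mem_filter, Finset.mem_univ, true_and,
      Finset.mem_image, ih, Fin.forall_fin_succ, IsWalk]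
    constructor
    · rintro ⟨t, ht, B, ⟨hB₁, hB₂⟩, rfl⟩
      exact ⟨⟨ht, hB₁⟩, fun j => ⟨t j, by simp, hB₂ j⟩⟩
    · rintro ⟨⟨h0, h1⟩, h2⟩
      choose t ht ht' using h2
      have hA : (fun j => (t j).toInt - (s j).toInt) = A 0 := funext fun j => by
        rw [← ht]
        ring
      exact ⟨t, hA ▸ h0, Fin.tail A, ⟨h1, ht'⟩, by rw [hA, Fin.cons_self_tail]⟩

theorem vertexWeight_one {ω : ℂ} (hω : ω ^ 2 + ω + 1 = 0) (h s k t : Bool) :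
    vertexWeight ω 1 1 h s k t = if h.toInt + (t.toInt - s.toInt) = k.toInt then 1 else 0 := by
  have : (2 + ω) / 3 * (1 - ω) = 1 := by linear_combination -hω / 3
  cases h <;> cases s <;> cases k <;> cases t <;> simp [vertexWeight, this]

open Classical in
/-- With all weights equal to `0` or `1`, the transfer operator sums over the rows of a matrix. -/
theorem rowTransfer_one {ω : ℂ} (hω : ω ^ 2 + ω + 1 = 0) (m : ℕ) (h : Bool) (f : List Bool → ℂ)
    (s : Fin m → Bool) :
    rowTransfer ω 1 (List.replicate m 1) h f (List.ofFn s) = ∑ t : Fin m → Bool,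
      if IsWalk m h fun j => (t j).toInt - (s j).toInt then f (List.ofFn t) else 0 := by
  induction m generalizing h f with
  | zero => simp [rowTransfer, IsWalk]
  | succ m ih =>
    rw [List.replicate_succ, List.ofFn_succ, rowTransfer_cons, Finset.sum_comm,
      ← (Fin.consEquiv fun _ => Bool).sum_comp, Fintype.sum_prod_type]
    refine Finset.sum_congr rfl fun t₀ _ => ?_
    simp only [ih, Finset.mul_sum]
    rw [Finset.sum_comm]
    refine Finset.sum_congr rfl fun t _ => ?_
    simp only [vertexWeight_one hω, IsWalk, Fin.consEquiv_apply, Fin.cons_zero, Fin.cons_succ,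
      List.ofFn_succ, Fintype.sum_bool, Bool.exists_bool]
    cases h <;> cases s 0 <;> cases t₀ <;> simp

theorem allTrue_ofFn {m : ℕ} (s : Fin m → Bool) [Decidable (s = fun _ => true)] :
    allTrue (List.ofFn s) = if s = fun _ => true then 1 else 0 := by
  simp [allTrue, funext_iff]

theorem card_walkMatrices {ω : ℂ} (hω : ω ^ 2 + ω + 1 = 0) (m k : ℕ) (s : Fin m → Bool) :
    ((walkMatrices m k s).card : ℂ) =
      partitionFn ω (List.replicate k 1) (List.replicate m 1) (List.ofFn s) := by
  classical
  induction k generalizing s with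
  | zero =>
    simp only [walkMatrices, List.replicate_zero, partitionFn, allTrue_ofFn]
    split_ifs <;> simp
  | succ k ih =>
    rw [walkMatrices, Finset.card_biUnion, List.replicate_succ, partitionFn, rowTransfer_one hω,
      ← Finset.sum_filter]
    · push_cast
      refine Finset.sum_congr (by congr) fun t _ => ?_
      rw [Finset.card_image_of_injective _ (Fin.cons_right_injective _), ih]
    · intro t _ t' _ htt'
      rw [Function.onFun, Finset.disjoint_left]
      intro A hA hA'
      obtain ⟨B, -, rfl⟩ := Finset.mem_image.1 hA
      obtain ⟨B', -, hB'⟩ := Finset.mem_image.1 hA'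
      refine htt' (funext fun j => Bool.toInt_injective ?_)
      have := congrFun (congrFun hB' 0) j
      simp only [Fin.cons_zero] at this
      omega

theorem theorem1 (n : ℕ) :
    (Set.ncard {A : Matrix (Fin n) (Fin n) ℤ | IsAlternatingSignMatrix A} : ℚ) =
      (∏ k ∈ Finset.range n, (Nat.factorial (3 * k + 1) : ℚ)) /
        ∏ k ∈ Finset.range n, (Nat.factorial (n + k) : ℚ) := by
  obtain ⟨ω, hω⟩ : ∃ ω : ℂ, ω ^ 2 + ω + 1 = 0 := by
    obtain ⟨ω, hω⟩ := IsAlgClosed.exists_root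
      (Polynomial.X ^ 2 + Polynomial.X + Polynomial.C 1 : Polynomial ℂ) (ne_of_eq_of_ne
        (b := 2) (by compute_degree!) (by norm_num))
    exact ⟨ω, by simpa using hω⟩
  have hset : {A : Fin n → Fin n → ℤ | IsAlternatingSignMatrix (Matrix.of A)} =
      walkMatrices n n fun _ => false := by
    ext A
    rw [Finset.mem_coe, mem_walkMatrices]
    simp only [← isAlternatingSeq_iff_isWalk]
    exact ⟨fun h => ⟨h.row, h.col⟩, fun h => ⟨h.1, h.2⟩⟩
  have hncard : Set.ncard {A : Matrix (Fin n) (Fin n) ℤ | IsAlternatingSignMatrix A} =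
      (walkMatrices n n fun _ => false).card :=
    (congrArg Set.ncard hset).trans (Set.ncard_coe_finset _)
  have hcard := card_walkMatrices hω n n fun _ => false
  rw [List.ofFn_const, partitionFn_one hω] at hcard
  rw [hncard]
  refine Rat.cast_injective (α := ℂ) ?_
  push_cast
  exact hcard
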